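/- All graphs are finite, simple and undirected. Let $r,\delta,n$ be positive integers with $\delta>r$ and $n\ge 2\delta+2$, and let $G$ be a graph of order $n$ with minimum degree $\delta$ and edge connectivity $r$, where the edge connectivity is the minimum cardinality of a set $U$ of edges of $G$ such that $G-U$ is disconnected. Let $\tau(G)$ denote the number of spanning trees of $G$. Then $$\tau(G)\le r(\delta+1)^{\delta-r}(n-\delta-1)^{n-\delta-r-2}\bigl[(\delta+1)(n-\delta-1)+n\bigr]^{r-1}.$$ Moreover, equality holds if and only if $G$ is isomorphic to $M^{r}_{n-\delta-1,\delta+1}$, the graph obtained from the disjoint union of the complete graphs $K_{n-\delta-1}$ and $K_{\delta+1}$ by adding $r$ pairwise disjoint edges between them. -/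

import Mathlib

namespace SpanningTreeMax

/-- The number of spanning trees of `G`: a spanning tree is a tree on the full vertex
set `V` all of whose edges are edges of `G`. -/
noncomputable def numSpanningTrees {V : Type*} (G : SimpleGraph V) : ℕ :=
  {T : SimpleGraph V | T ≤ G ∧ T.IsTree}.ncard

/-- `U` is an edge cut of `G`: a set of edges of `G` whose deletion leaves a graph that is
not connected. -/
def IsEdgeCut {V : Type*} (G : SimpleGraph V) (U : Set (Sym2 V)) : Prop :=
  U ⊆ G.edgeSet ∧ ¬ (G.deleteEdges U).Connected

/-- The edge connectivity of `G`: the minimum cardinality of an edge cut. It is `0` if `G` is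
disconnected (the empty set is then a cut) and, by the convention `sInf ∅ = 0`, if `G` has
exactly one vertex (there is then no cut). -/
noncomputable def edgeConnectivity {V : Type*} (G : SimpleGraph V) : ℕ :=
  sInf {k : ℕ | ∃ U : Set (Sym2 V), IsEdgeCut G U ∧ U.ncard = k}

/-- Two vertex-disjoint complete graphs, on `a` and on `b` vertices, together with `q` mutually
disjoint edges between them: the `i`-th vertex of the first is joined to the `i`-th vertex of
the second for every `i < q` (used for `q ≤ a` and `q ≤ b`). -/
def joinedCliques (a b q : ℕ) : SimpleGraph (Fin a ⊕ Fin b) where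
  Adj x y :=
    match x, y with
    | .inl i, .inl j => i ≠ j
    | .inr i, .inr j => i ≠ j
    | .inl i, .inr j => (i : ℕ) = (j : ℕ) ∧ (i : ℕ) < q
    | .inr j, .inl i => (i : ℕ) = (j : ℕ) ∧ (i : ℕ) < q
  symm := ⟨by
    rintro (i | i) (j | j) h
    · exact Ne.symm h
    · exact h
    · exact h
    · exact Ne.symm h⟩
  loopless := ⟨by
    rintro (i | i) h
    · exact h rfl
    · exact h rfl⟩

end SpanningTreeMax

/-! Take a minimum edge cut, with `r` edges between `S` and its complement. As `r < δ`, each side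
has at least `δ + 1` vertices (`minDegree_lt_card`). Completing both sides to cliques of orders `a`
and `b` keeps the cut and cannot lose spanning trees; as `G` is connected, it gains some unless
nothing is added (`eq_of_numSpanningTrees_eq`).

For two cliques joined by `r` edges, Kirchhoff's theorem and a low-rank determinant reduction give
`τ = a^(a-2) b^(b-2) · det K · (1ᵀ K⁻¹ 1)`. Here `K = 1 + Xᵀ D⁻¹ X` is indexed by the cut edges, `X`
is their signed incidence matrix, and `D` is diagonal with entry `a` on `S` and `b` off it. Every
diagonal entry of `K` is `c = 1 + 1/a + 1/b`; an off-diagonal entry is nonnegative and vanishes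
exactly when the two edges are disjoint. The factor `det K · (1ᵀ K⁻¹ 1)` is `r` times the
determinant of `K` compressed to vectors of sum zero, so AM-GM on eigenvalues bounds it by `r
c^(r-1)`, with equality only for a matching (`det_mul_sum_inv_le`, `numSpanningTrees_le_of_full`).

With `a + b = n` fixed, the resulting bound strictly grows as the partition becomes less balanced
(`joinedCliquesCount_lt`), so its maximum is at `b = δ + 1`. Equality in the theorem forces equality
at every stage. -/

namespace SpanningTreeMax

open Matrix Finset

/-! ### Kirchhoff's theorem, by expanding the Laplacian over parent maps. -/

section MatrixTree

variable {V : Type*}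

/-- Every vertex reaches `v` by iterating `f`. -/
def ReachesRoot (v : V) (f : V → V) : Prop := ∀ u, ∃ k, f^[k] u = v

/-- The graph with edges `{u, f u}`, for `u ≠ v`. -/
def parentGraph (v : V) (f : V → V) : SimpleGraph V :=
  SimpleGraph.fromEdgeSet ((fun u => s(u, f u)) '' {u | u ≠ v})

/-- The number of iterations of `f` needed to reach `v`. -/
noncomputable def rootDepth (v : V) (f : V → V) (u : V) : ℕ :=
  sInf {k | f^[k] u = v}

theorem iterate_rootDepth {v : V} {f : V → V} (h : ReachesRoot v f) (u : V) :
    f^[rootDepth v f u] u = v :=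
  Nat.sInf_mem (s := {k | f^[k] u = v}) (h u)

theorem rootDepth_apply_lt {v : V} {f : V → V} (h : ReachesRoot v f) {u : V} (hu : u ≠ v) :
    rootDepth v f (f u) < rootDepth v f u := by
  have h1 := iterate_rootDepth h u
  rcases hk : rootDepth v f u with _ | k
  · rw [hk] at h1
    exact absurd h1 hu
  · rw [hk, Function.iterate_succ_apply] at h1
    exact Nat.lt_succ_of_le (Nat.sInf_le h1)

theorem ReachesRoot.apply_ne_self {v : V} {f : V → V} (h : ReachesRoot v f) {u : V}
    (hu : u ≠ v) : u ≠ f u := fun e => by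
  have := rootDepth_apply_lt h hu
  rw [← e] at this
  exact this.false

theorem ReachesRoot.parentGraph_adj {v : V} {f : V → V} (h : ReachesRoot v f) {u : V}
    (hu : u ≠ v) : (parentGraph v f).Adj u (f u) := by
  rw [parentGraph, SimpleGraph.fromEdgeSet_adj]
  exact ⟨⟨u, hu, rfl⟩, h.apply_ne_self hu⟩

theorem ReachesRoot.parentGraph_connected {v : V} {f : V → V} (h : ReachesRoot v f) :
    (parentGraph v f).Connected := by
  have key : ∀ k u, rootDepth v f u = k → (parentGraph v f).Reachable u v := by
    intro k
    induction k using Nat.strong_induction_on with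
    | _ k ih =>
      intro u hu
      by_cases huv : u = v
      · rw [huv]
      · exact (h.parentGraph_adj huv).reachable.trans
          (ih _ (hu ▸ rootDepth_apply_lt h huv) (f u) rfl)
  have : Nonempty V := ⟨v⟩
  exact ⟨fun u w => (key _ u rfl).trans (key _ w rfl).symm⟩

theorem parentGraph_ncard_edgeSet_le [Finite V] (v : V) (f : V → V) :
    (parentGraph v f).edgeSet.ncard + 1 ≤ Nat.card V := by
  have h1 : (parentGraph v f).edgeSet.ncard ≤ ({u | u ≠ v} : Set V).ncard := by
    rw [parentGraph, SimpleGraph.edgeSet_fromEdgeSet]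
    exact (Set.ncard_le_ncard Set.sdiff_subset (Set.toFinite _)).trans
      (Set.ncard_image_le (Set.toFinite _))
  have h2 : ({u | u ≠ v} : Set V).ncard + ({v} : Set V).ncard = Nat.card V := by
    have h3 : ({u | u ≠ v} : Set V) = ({v} : Set V)ᶜ := by ext; simp
    rw [h3, add_comm, Set.ncard_add_ncard_compl]
  rw [Set.ncard_singleton] at h2
  omega

theorem ReachesRoot.parentGraph_isTree [Finite V] {v : V} {f : V → V} (h : ReachesRoot v f) :
    (parentGraph v f).IsTree := by
  rw [SimpleGraph.isTree_iff_connected_and_card]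
  refine ⟨h.parentGraph_connected, ?_⟩
  have h1 := h.parentGraph_connected.card_vert_le_card_edgeSet_add_one
  have h2 := parentGraph_ncard_edgeSet_le v f
  rw [← Nat.card_coe_set_eq] at h2
  omega

/-- Induction on depth. If the edge `{u, f u}` came from `g` pointing at `u` from `f u`, then by
induction `f (f u) = u`, and the depth would drop along both `u → f u` and `f u → u`. -/
theorem parentGraph_injective {v : V} {f g : V → V} (hf : ReachesRoot v f)
    (hfv : f v = v) (hgv : g v = v) (h : parentGraph v f = parentGraph v g) : f = g := by
  have key : ∀ k u, rootDepth v f u = k → f u = g u := by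
    intro k
    induction k using Nat.strong_induction_on with
    | _ k ih =>
      intro u hu
      by_cases huv : u = v
      · rw [huv, hfv, hgv]
      have h1 := hf.parentGraph_adj huv
      rw [h, parentGraph, SimpleGraph.fromEdgeSet_adj] at h1
      obtain ⟨⟨w, hw, hwe⟩, -⟩ := h1
      rcases Sym2.eq_iff.1 hwe with ⟨h2, h3⟩ | ⟨h2, h3⟩
      · rw [← h3, h2]
      · subst h2
        have h4 := rootDepth_apply_lt hf huv
        have h5 := ih _ (hu ▸ h4) _ rfl
        rw [h3] at h5
        have h6 := rootDepth_apply_lt hf hw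
        rw [h5] at h6
        omega
  exact funext fun u => key _ u rfl

/-- The parent of `u` is a neighbour closer to `v`. The parent graph is then connected and contained
in `T`, and a tree is minimal among connected graphs. -/
theorem _root_.SimpleGraph.IsTree.exists_parentGraph_eq [Finite V] {T : SimpleGraph V}
    (hT : T.IsTree) (v : V) :
    ∃ f : V → V, f v = v ∧ (∀ u, u ≠ v → T.Adj u (f u)) ∧ ReachesRoot v f ∧
      parentGraph v f = T := by
  have hstep : ∀ u, u ≠ v → ∃ w, T.Adj u w ∧ T.dist w v < T.dist u v := by
    intro u hu
    obtain ⟨p, hp⟩ := (hT.connected u v).exists_walk_length_eq_dist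
    cases p with
    | nil => exact absurd rfl hu
    | cons hadj q =>
      refine ⟨_, hadj, ?_⟩
      have := SimpleGraph.dist_le q
      rw [SimpleGraph.Walk.length_cons] at hp
      omega
  classical
  choose! f hf using hstep
  let g : V → V := fun u => if u = v then v else f u
  have hgv : g v = v := if_pos rfl
  have hg : ∀ u, u ≠ v → g u = f u := fun u hu => if_neg hu
  have hadj : ∀ u, u ≠ v → T.Adj u (g u) := fun u hu => by rw [hg u hu]; exact (hf u hu).1
  have hreach : ReachesRoot v g := by
    have key : ∀ k u, T.dist u v = k → ∃ k, g^[k] u = v := by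
      intro k
      induction k using Nat.strong_induction_on with
      | _ k ih =>
        intro u hu
        by_cases huv : u = v
        · exact ⟨0, huv⟩
        · obtain ⟨m, hm⟩ := ih _ (hu ▸ (hf u huv).2) _ rfl
          exact ⟨m + 1, by rw [Function.iterate_succ_apply, hg u huv, hm]⟩
    exact fun u => key _ u rfl
  refine ⟨g, hgv, hadj, hreach, ?_⟩
  have hle : parentGraph v g ≤ T := by
    intro x y hxy
    rw [parentGraph, SimpleGraph.fromEdgeSet_adj] at hxy
    obtain ⟨⟨u, hu, he⟩, -⟩ := hxy
    rw [← SimpleGraph.mem_edgeSet, ← he]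
    exact hadj u hu
  exact le_antisymm hle
    ((SimpleGraph.isTree_iff_minimal_connected.1 hT).2 hreach.parentGraph_connected hle)

variable [Fintype V] [DecidableEq V]

/-- The `u`-th row of the matrix recording the parent pointer `u ↦ w`, with root `v`. -/
def parentRow (v u w : V) : V → ℝ :=
  if u = v then Pi.single v 1 else Pi.single u 1 - Pi.single w 1

/-- Ordered by depth, the matrix is triangular with unit diagonal: a row has its only other nonzero
entry at the parent, which is strictly less deep. -/
theorem det_parentRow_of_reachesRoot {v : V} {f : V → V} (h : ReachesRoot v f) :
    (of fun u => parentRow v u (f u)).det = 1 := by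
  have hne : ∀ i j, i ≠ j → rootDepth v f i ≤ rootDepth v f j →
      (of fun u => parentRow v u (f u)) i j = 0 := by
    intro i j hij hd
    by_cases hi : i = v
    · subst hi
      simp [parentRow, hij.symm]
    · have h1 := rootDepth_apply_lt h hi
      have h2 : j ≠ f i := by
        rintro rfl
        omega
      simp [parentRow, hi, hij.symm, h2]
  have hdiag : ∀ i, (of fun u => parentRow v u (f u)) i i = 1 := by
    intro i
    by_cases hi : i = v
    · subst hi
      simp [parentRow]
    · simp [parentRow, hi, h.apply_ne_self hi]
  have hbt : (of fun u => parentRow v u (f u)).BlockTriangular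
      (fun u => OrderDual.toDual (rootDepth v f u)) := by
    intro i j hij
    have hij' : rootDepth v f i < rootDepth v f j := hij
    exact hne i j (by rintro rfl; exact hij'.false) hij'.le
  rw [hbt.det]
  refine Finset.prod_eq_one fun a _ => ?_
  refine Eq.trans (congrArg _ ?_) Matrix.det_one
  ext ⟨i, hi⟩ ⟨j, hj⟩
  rw [toSquareBlock_def, of_apply]
  by_cases hij : i = j
  · subst hij
    rw [hdiag, one_apply_eq]
  · rw [one_apply_ne (by simpa using hij)]
    exact hne i j hij (OrderDual.toDual.injective (hi.trans hj.symm)).le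

/-- The indicator of the vertices that never reach `v` is a nonzero kernel vector, since `u ≠ v`
reaches `v` exactly when `f u` does. -/
theorem det_parentRow_of_not_reachesRoot {v : V} {f : V → V} (h : ¬ ReachesRoot v f) :
    (of fun u => parentRow v u (f u)).det = 0 := by
  classical
  obtain ⟨u₀, hu₀⟩ := not_forall.1 h
  refine exists_mulVec_eq_zero_iff.1
    ⟨fun u => if ∃ k, f^[k] u = v then 0 else 1, fun e => ?_, ?_⟩
  · have := congrFun e u₀
    simp [hu₀] at this
  · funext u
    by_cases hu : u = v
    · subst hu
      have : ∃ k, f^[k] u = u := ⟨0, rfl⟩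
      simp [mulVec, parentRow, this]
    · have : (∃ k, f^[k] (f u) = v) ↔ ∃ k, f^[k] u = v := by
        constructor
        · rintro ⟨k, hk⟩
          exact ⟨k + 1, hk⟩
        · rintro ⟨_ | k, hk⟩
          · exact absurd hk hu
          · exact ⟨k, hk⟩
      change parentRow v u (f u) ⬝ᵥ _ = 0
      rw [parentRow, if_neg hu, sub_dotProduct]
      simp [this]

variable (G : SimpleGraph V) [DecidableRel G.Adj]

/-- The admissible parents of a vertex, with root `v`. -/
def parentChoices (v u : V) : Finset V := if u = v then {v} else G.neighborFinset u

/-- Writing each row as a sum over possible parents lets multilinearity of the determinant expand it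
as a sum over parent maps. -/
theorem lapMatrix_updateRow_eq (v : V) :
    (G.lapMatrix ℝ).updateRow v (Pi.single v 1) =
      fun u => ∑ w ∈ parentChoices G v u, parentRow v u w := by
  funext u
  by_cases hu : u = v
  · subst hu
    simp [parentChoices, parentRow]
  · rw [updateRow_ne hu]
    funext x
    simp only [parentChoices, parentRow, hu, if_false, sum_sub_distrib, sum_const,
      SimpleGraph.card_neighborFinset_eq_degree, Pi.sub_apply, SimpleGraph.lapMatrix,
      SimpleGraph.degMatrix, Matrix.sub_apply, SimpleGraph.adjMatrix_apply, Finset.sum_apply]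
    congr 1
    · by_cases hx : u = x
      · subst hx
        simp
      · simp [hx, Ne.symm hx]
    · simp [Pi.single_apply]

theorem numSpanningTrees_eq_card [DecidablePred (ReachesRoot (V := V) v)] :
    numSpanningTrees G =
      #{f ∈ Fintype.piFinset (parentChoices G v) | ReachesRoot v f} := by
  have hmem : ∀ f : V → V, f ∈ Fintype.piFinset (parentChoices G v) ↔
      f v = v ∧ ∀ u, u ≠ v → G.Adj u (f u) := by
    intro f
    rw [Fintype.mem_piFinset]
    constructor
    · intro h
      refine ⟨by simpa [parentChoices] using h v, fun u hu => ?_⟩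
      simpa [parentChoices, hu] using h u
    · rintro ⟨h1, h2⟩ u
      by_cases hu : u = v
      · subst hu
        simpa [parentChoices] using h1
      · simpa [parentChoices, hu] using h2 u hu
  rw [numSpanningTrees, ← Set.ncard_coe_finset]
  rw [← Set.InjOn.ncard_image (f := parentGraph v)]
  · congr 1
    ext T
    simp only [Set.mem_ofPred_eq, Set.mem_image, coe_filter, hmem]
    constructor
    · rintro ⟨hle, hT⟩
      obtain ⟨f, h1, h2, h3, h4⟩ := hT.exists_parentGraph_eq v
      exact ⟨f, ⟨⟨h1, fun u hu => hle (h2 u hu)⟩, h3⟩, h4⟩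
    · rintro ⟨f, ⟨⟨h1, h2⟩, h3⟩, rfl⟩
      refine ⟨?_, h3.parentGraph_isTree⟩
      intro x y hxy
      rw [parentGraph, SimpleGraph.fromEdgeSet_adj] at hxy
      obtain ⟨⟨u, hu, he⟩, -⟩ := hxy
      rw [← SimpleGraph.mem_edgeSet, ← he]
      exact h2 u hu
  · intro f hf g hg hfg
    simp only [coe_filter, Set.mem_ofPred_eq, hmem] at hf hg
    exact parentGraph_injective hf.2 hf.1.1 hg.1.1 hfg

/-- **Kirchhoff's matrix tree theorem**, with the row of the root replaced by a unit vector. -/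
theorem det_lapMatrix_updateRow (v : V) :
    ((G.lapMatrix ℝ).updateRow v (Pi.single v 1)).det = numSpanningTrees G := by
  classical
  rw [lapMatrix_updateRow_eq, numSpanningTrees_eq_card (v := v) G, card_filter, Nat.cast_sum]
  refine (MultilinearMap.map_sum_finset (detRowAlternating (n := V) (R := ℝ)).toMultilinearMap
    (fun u w => parentRow v u w) (parentChoices G v)).trans (sum_congr rfl fun f _ => ?_)
  by_cases hf : ReachesRoot v f
  · rw [if_pos hf, Nat.cast_one]
    exact det_parentRow_of_reachesRoot hf
  · rw [if_neg hf, Nat.cast_zero]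
    exact det_parentRow_of_not_reachesRoot hf

theorem det_add_vecMulVec (A : Matrix V V ℝ) (hA : A.det ≠ 0) (u w : V → ℝ) :
    (A + vecMulVec u w).det = A.det * (1 + w ⬝ᵥ A⁻¹ *ᵥ u) := by
  rw [vecMulVec_eq Unit, det_add_replicateCol_mul_replicateRow (Ne.isUnit hA),
    Matrix.mul_assoc, ← replicateCol_mulVec, det_unique (n := Unit), Matrix.add_apply, one_apply_eq,
    replicateRow_mul_replicateCol_apply]

theorem det_one_add_vecMulVec (u w : V → ℝ) :
    (1 + vecMulVec u w).det = 1 + w ⬝ᵥ u := by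
  rw [vecMulVec_eq Unit, det_one_add_replicateCol_mul_replicateRow]

/-- The perturbation adds a unit vector to row `v` only; by linearity in that row the unperturbed
part contributes `det L = 0`. -/
theorem det_lapMatrix_add_single (v : V) :
    (G.lapMatrix ℝ + vecMulVec (Pi.single v 1) (Pi.single v 1) : Matrix V V ℝ).det = numSpanningTrees G := by
  have : Nonempty V := ⟨v⟩
  have h : G.lapMatrix ℝ + vecMulVec (Pi.single v 1) (Pi.single v 1) =
      (G.lapMatrix ℝ).updateRow v (G.lapMatrix ℝ v + Pi.single v 1) := by
    ext i j
    by_cases hi : i = v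
    · subst hi
      simp [vecMulVec_apply]
    · simp [hi, vecMulVec_apply]
  rw [h, det_updateRow_add, updateRow_eq_self, SimpleGraph.det_lapMatrix_eq_zero, zero_add,
    det_lapMatrix_updateRow]

/-- **Kirchhoff's matrix tree theorem** for the Laplacian perturbed by a rank one matrix. -/
theorem det_lapMatrix_add_vecMulVec [Nonempty V] (s : V → ℝ) :
    (G.lapMatrix ℝ + vecMulVec s s).det = (∑ u, s u) ^ 2 * numSpanningTrees G := by
  obtain ⟨v⟩ := ‹Nonempty V›
  set e : V → ℝ := Pi.single v 1 with he
  set y := s - e with hy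
  set o : V → ℝ := fun _ => 1 with ho
  have hL : G.lapMatrix ℝ *ᵥ o = 0 := G.lapMatrix_mulVec_const_eq_zero
  have hL' : o ᵥ* G.lapMatrix ℝ = 0 := by
    rw [← mulVec_transpose, (G.isSymm_lapMatrix ℝ).eq, hL]
  have hyo : y ⬝ᵥ o = ∑ u, s u - 1 := by
    simp [hy, ho, he, dotProduct]
  have hoe : o ⬝ᵥ e = 1 := by simp [ho, he]
  have heo : e ⬝ᵥ o = 1 := by simp [ho, he]
  -- The Laplacian kills constants on both sides, so these two factors leave it alone and turn `e`
  -- into `e + y = s`. Each has determinant `∑ u, s u`, whence the square.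
  have key : (1 + vecMulVec y o) * (G.lapMatrix ℝ + vecMulVec e e) * (1 + vecMulVec o y) =
      G.lapMatrix ℝ + vecMulVec s s := by
    have h1 : (1 + vecMulVec y o) * (G.lapMatrix ℝ + vecMulVec e e) =
        G.lapMatrix ℝ + vecMulVec s e := by
      rw [add_mul, one_mul, mul_add, vecMulVec_mul, hL', vecMulVec_mul_vecMulVec, hoe, one_smul,
        vecMulVec_zero, zero_add, add_assoc,
        ← add_vecMulVec, hy, add_sub_cancel]
    rw [h1, mul_add, mul_one, add_mul, mul_vecMulVec, hL, vecMulVec_mul_vecMulVec, heo, one_smul,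
      zero_vecMulVec, zero_add, add_assoc, ← vecMulVec_add, hy, add_sub_cancel]
  rw [← key, det_mul, det_mul, det_one_add_vecMulVec, det_one_add_vecMulVec,
    det_lapMatrix_add_single, dotProduct_comm o y, hyo]
  ring

end MatrixTree

/-! ### AM-GM for the compression of a positive definite matrix to vectors of sum zero. -/

section Determinants

variable {E : Type*} [Fintype E] [DecidableEq E]

/-- The inequality of arithmetic and geometric means for the eigenvalues of a matrix. -/
theorem _root_.Matrix.PosSemidef.det_le_trace_div_card_pow [Nonempty E] {C : Matrix E E ℝ}
    (hC : C.PosSemidef) : C.det ≤ (C.trace / Fintype.card E) ^ Fintype.card E := by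
  have hr : (0 : ℝ) < Fintype.card E := by exact_mod_cast Fintype.card_pos
  have hz : ∀ i ∈ (univ : Finset E), 0 ≤ hC.1.eigenvalues i := fun i _ => hC.eigenvalues_nonneg i
  have h := Real.geom_mean_le_arith_mean univ (fun _ => 1) hC.1.eigenvalues
    (fun _ _ => zero_le_one) (by simpa using hr) hz
  simp only [Real.rpow_one, sum_const, card_univ, nsmul_eq_mul, mul_one, one_mul] at h
  have hdet : C.det = ∏ i, hC.1.eigenvalues i := by simpa using hC.1.det_eq_prod_eigenvalues
  have htr : C.trace = ∑ i, hC.1.eigenvalues i := by simpa using hC.1.trace_eq_sum_eigenvalues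
  rw [hdet, htr, ← Real.rpow_inv_natCast_pow (prod_nonneg hz)
    (Fintype.card_ne_zero (α := E))]
  exact pow_le_pow_left₀ (Real.rpow_nonneg (prod_nonneg hz) _) h _

/-- Adding `c` times the projection onto constants makes the compression a full-size matrix, so that
its determinant and trace are available while the constant direction contributes only the eigenvalue
`c`. -/
theorem det_compression {K : Matrix E E ℝ} (hK : K.det ≠ 0) [Nonempty E] (c : ℝ) :
    ((1 - (Fintype.card E : ℝ)⁻¹ • vecMulVec 1 1) * K *
        (1 - (Fintype.card E : ℝ)⁻¹ • vecMulVec 1 1) +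
          c • (Fintype.card E : ℝ)⁻¹ • vecMulVec 1 1).det =
      c / Fintype.card E * (K.det * (1 ⬝ᵥ K⁻¹ *ᵥ 1)) := by
  have hr : (Fintype.card E : ℝ) ≠ 0 := by exact_mod_cast Fintype.card_ne_zero
  set r := (Fintype.card E : ℝ) with hrdef
  have h11 : (1 : E → ℝ) ⬝ᵥ 1 = r := by simp [hrdef]
  set Q : Matrix E E ℝ := r⁻¹ • vecMulVec 1 1 with hQ
  set P : Matrix E E ℝ := 1 - Q with hP
  have hQQ : Q * Q = Q := by
    rw [hQ, smul_mul_smul_comm, vecMulVec_mul_vecMulVec, h11, vecMulVec_smul, smul_smul]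
    congr 1
    field_simp
  have hQP : Q * P = 0 := by rw [hP, mul_sub, mul_one, hQQ, sub_self]
  have hoP : (1 : E → ℝ) ᵥ* P = 0 := by
    rw [hP, hQ, vecMul_sub, vecMul_one, vecMul_smul, vecMul_vecMulVec, h11, smul_smul,
      inv_mul_cancel₀ hr, one_smul, sub_self]
  -- `Q * P = 0` makes `P * K * Q` square to zero, so the left factor has determinant 1. Both
  -- factors on the right are rank-one perturbations of matrices with known determinant.
  have key : (1 + P * K * Q) * (P * K * P + c • Q) = (P * K + Q) * (P + c • Q) := by
    have hQP' : ∀ Y, Q * (P * Y) = 0 := fun Y => by rw [← mul_assoc, hQP, zero_mul]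
    simp only [add_mul, mul_add, one_mul, mul_assoc, hQP', hQP, hQQ, mul_smul_comm, mul_zero]
    abel_nf
  have h1 : (1 + P * K * Q).det = 1 := by
    have : P * K * Q = vecMulVec (r⁻¹ • (P * K) *ᵥ 1) 1 := by
      rw [hQ, mul_smul_comm, mul_vecMulVec, smul_vecMulVec]
    rw [this, det_one_add_vecMulVec, dotProduct_smul, ← mulVec_mulVec, dotProduct_mulVec, hoP,
      zero_dotProduct, smul_zero, add_zero]
  have h2 : (P + c • Q).det = c := by
    have : P + c • Q = 1 + vecMulVec (((c - 1) * r⁻¹) • 1) 1 := by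
      rw [smul_vecMulVec, mul_smul, ← hQ, hP, sub_smul, one_smul]
      abel
    rw [this, det_one_add_vecMulVec, dotProduct_smul, h11, smul_eq_mul, mul_assoc,
      inv_mul_cancel₀ hr]
    ring
  have h3 : (P * K + Q).det = K.det * (1 ⬝ᵥ K⁻¹ *ᵥ 1) / r := by
    have : P * K + Q = (1 + vecMulVec (r⁻¹ • 1) (1 ᵥ* (K⁻¹ - 1))) * K := by
      rw [← vecMulVec_mul, smul_vecMulVec, ← hQ, mul_sub, mul_one, add_mul, one_mul, hP, sub_mul,
        one_mul, sub_mul (Q * K⁻¹), mul_assoc, nonsing_inv_mul _ (Ne.isUnit hK), mul_one]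
      abel
    rw [this, det_mul, det_one_add_vecMulVec, dotProduct_smul, ← dotProduct_mulVec, sub_mulVec,
      one_mulVec, dotProduct_sub, h11, smul_eq_mul]
    field_simp
    ring
  have := congrArg det key
  rw [det_mul, det_mul, h1, h2, h3, one_mul] at this
  rw [this]
  ring

/-- Up to the factor `card E`, the left side is the determinant of the compression of `K` to the
vectors of sum zero. -/
theorem det_mul_sum_inv_le [Nonempty E] {K : Matrix E E ℝ} (hK : K.PosDef) {c : ℝ} (hc : 0 < c)
    (hdiag : ∀ e, K e e = c) (hoff : ∀ e f, 0 ≤ K e f) :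
    K.det * (1 ⬝ᵥ K⁻¹ *ᵥ 1) ≤ Fintype.card E * c ^ (Fintype.card E - 1) ∧
      (K.det * (1 ⬝ᵥ K⁻¹ *ᵥ 1) = Fintype.card E * c ^ (Fintype.card E - 1) ↔
        ∀ e f, e ≠ f → K e f = 0) := by
  have hdet : K.det ≠ 0 := hK.det_pos.ne'
  have hrpos : (0 : ℝ) < Fintype.card E := by exact_mod_cast Fintype.card_pos
  have h11 : (1 : E → ℝ) ⬝ᵥ 1 = Fintype.card E := by simp
  have hcomp := det_compression hdet c
  set Φ := K.det * (1 ⬝ᵥ K⁻¹ *ᵥ 1) with hΦ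
  set Q : Matrix E E ℝ := (Fintype.card E : ℝ)⁻¹ • vecMulVec 1 1 with hQ
  have hQpsd : Q.PosSemidef := by
    have := posSemidef_vecMulVec_self_star (1 : E → ℝ)
    rw [star_trivial] at this
    exact this.smul (inv_nonneg.2 hrpos.le)
  have hQQ : Q * Q = Q := by
    rw [hQ, smul_mul_smul_comm, vecMulVec_mul_vecMulVec, h11, vecMulVec_smul, smul_smul]
    congr 1
    field_simp
  have hPH : (1 - Q)ᴴ = 1 - Q := by rw [conjTranspose_sub, conjTranspose_one, hQpsd.1.eq]
  have hCpsd : ((1 - Q) * K * (1 - Q) + c • Q).PosSemidef := by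
    refine PosSemidef.add ?_ (hQpsd.smul hc.le)
    have := hK.posSemidef.conjTranspose_mul_mul_same (1 - Q)
    rwa [hPH] at this
  set σ := ∑ e, ∑ f ∈ univ.erase e, K e f with hσ
  have hσ0 : 0 ≤ σ := sum_nonneg fun e _ => sum_nonneg fun f _ => hoff e f
  have hsum : (1 : E → ℝ) ⬝ᵥ K *ᵥ 1 = Fintype.card E * c + σ := by
    simp only [dotProduct, mulVec, Pi.one_apply, one_mul, mul_one, hσ]
    rw [← nsmul_eq_mul, ← card_univ, ← sum_const, ← sum_add_distrib]
    exact sum_congr rfl fun e _ => by rw [← hdiag e, add_sum_erase _ _ (mem_univ e)]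
  -- Removing the constant direction costs the mean `c + σ / r` of the row sums, where `r = card E`,
  -- and `c • Q` restores `c`. The net loss `σ / r` is what makes AM-GM strict when some
  -- off-diagonal entry is positive.
  have htr : ((1 - Q) * K * (1 - Q) + c • Q).trace =
      Fintype.card E * (c - σ / (Fintype.card E) ^ 2) := by
    have h1 : ((1 - Q) * K * (1 - Q)).trace = (K - K * Q).trace := by
      rw [trace_mul_comm, ← mul_assoc, sub_mul (1 : Matrix E E ℝ), mul_sub (1 : Matrix E E ℝ),
        mul_sub Q, hQQ, one_mul, mul_one, one_mul, sub_self, sub_zero, sub_mul, one_mul,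
        trace_sub, trace_sub, trace_mul_comm Q]
    have h2 : (K * Q).trace = (Fintype.card E : ℝ)⁻¹ * (Fintype.card E * c + σ) := by
      rw [hQ, mul_smul_comm, mul_vecMulVec, trace_smul, trace_vecMulVec, dotProduct_comm, hsum,
        smul_eq_mul]
    have h3 : K.trace = Fintype.card E * c := by simp [trace, hdiag]
    have h4 : Q.trace = 1 := by
      rw [hQ, trace_smul, trace_vecMulVec, h11, smul_eq_mul, inv_mul_cancel₀ hrpos.ne']
    rw [trace_add, h1, trace_sub, h2, h3, trace_smul, h4, smul_eq_mul]
    field_simp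
    ring
  have hle := hCpsd.det_le_trace_div_card_pow
  rw [hcomp, htr, mul_div_cancel_left₀ _ hrpos.ne'] at hle
  have hcr : c ^ Fintype.card E = c * c ^ (Fintype.card E - 1) :=
    (mul_pow_sub_one Fintype.card_ne_zero c).symm
  have hnn : 0 ≤ c - σ / (Fintype.card E) ^ 2 := by
    have := hCpsd.trace_nonneg
    rw [htr] at this
    exact nonneg_of_mul_nonneg_right this hrpos
  have hscale : ∀ t : ℝ, c / Fintype.card E * Φ ≤ c * t ↔ Φ ≤ Fintype.card E * t := by
    intro t
    rw [div_mul_eq_mul_div, mul_div_assoc, mul_le_mul_iff_right₀ hc, div_le_iff₀ hrpos, mul_comm t]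
  have hσiff : σ = 0 ↔ ∀ e f, e ≠ f → K e f = 0 := by
    rw [hσ, sum_eq_zero_iff_of_nonneg fun e _ => sum_nonneg fun f _ => hoff e f]
    refine ⟨fun h e f hef => ?_, fun h e _ => sum_eq_zero fun f hf => h e f (ne_of_mem_erase hf).symm⟩
    exact (sum_eq_zero_iff_of_nonneg fun f _ => hoff e f).1 (h e (mem_univ e)) f
      (mem_erase.2 ⟨hef.symm, mem_univ f⟩)
  refine ⟨(hscale _).1 ?_, ?_⟩
  · rw [← hcr]
    refine hle.trans (pow_le_pow_left₀ hnn (sub_le_self _ (by positivity)) _)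
  · constructor
    · intro heq
      rw [← hσiff]
      by_contra hne
      have hσpos : 0 < σ := lt_of_le_of_ne hσ0 (Ne.symm hne)
      have hlt : (c - σ / (Fintype.card E) ^ 2) ^ Fintype.card E < c ^ Fintype.card E :=
        pow_lt_pow_left₀ (sub_lt_self _ (by positivity)) hnn Fintype.card_ne_zero
      have h5 := hle.trans_lt hlt
      rw [hcr] at h5
      exact h5.not_ge ((by rw [heq]; field_simp; rfl))
    · intro h
      have hKc : K = c • (1 : Matrix E E ℝ) := by
        ext e f
        by_cases hef : e = f
        · subst hef
          simp [hdiag]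
        · simp [h e f hef, hef]
      have hinv : K⁻¹ = c⁻¹ • (1 : Matrix E E ℝ) := by
        refine inv_eq_right_inv ?_
        rw [hKc, smul_mul_smul_comm, mul_inv_cancel₀ hc.ne', one_smul, one_mul]
      rw [hΦ, hinv, hKc, det_smul, det_one, mul_one, smul_mulVec, one_mulVec, dotProduct_smul, h11,
        hcr, smul_eq_mul]
      field_simp

end Determinants

/-! ### Passing from a determinant over vertices to one over cut edges. -/

section Incidence

variable {V E : Type*} [Fintype V] [DecidableEq V] [Fintype E] [DecidableEq E]

/-- Reduction of a determinant over vertices to one over the columns of `X`. -/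
theorem det_diagonal_add_sub_vecMulVec {d : V → ℝ} (hd : ∀ u, 0 < d u) (X : Matrix V E ℝ)
    {q : V → ℝ} {b : ℝ} (hb : 0 < b) (hq : ∀ u, d u * q u = b * q u) (hqq : q ⬝ᵥ q = b)
    (hXq : Xᵀ *ᵥ q = -1) (hK : (1 + Xᵀ * diagonal (fun u => (d u)⁻¹) * X).det ≠ 0) :
    b ^ 2 * (diagonal d + X * Xᵀ - vecMulVec q q).det =
      (∏ u, d u) * ((1 + Xᵀ * diagonal (fun u => (d u)⁻¹) * X).det *
        (1 ⬝ᵥ (1 + Xᵀ * diagonal (fun u => (d u)⁻¹) * X)⁻¹ *ᵥ 1)) := by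
  set K := 1 + Xᵀ * diagonal (fun u => (d u)⁻¹) * X with hKdef
  have hD : IsUnit (diagonal d).det := by
    rw [det_diagonal]
    exact (prod_pos fun u _ => hd u).ne'.isUnit
  have hDinv : (diagonal d)⁻¹ = diagonal (fun u => (d u)⁻¹) := by
    refine inv_eq_right_inv ?_
    rw [diagonal_mul_diagonal, ← diagonal_one]
    exact congrArg _ (funext fun u => mul_inv_cancel₀ (hd u).ne')
  have hN : (diagonal d + X * Xᵀ).det = (∏ u, d u) * K.det := by
    rw [det_add_mul X Xᵀ hD, det_diagonal, hDinv, hKdef]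
  have hN0 : (diagonal d + X * Xᵀ).det ≠ 0 := by
    rw [hN]
    exact mul_ne_zero (prod_pos fun u _ => hd u).ne' hK
  have hDq : diagonal d *ᵥ q = b • q := by
    funext u
    rw [mulVec_diagonal, hq, Pi.smul_apply, smul_eq_mul]
  have hDDi : diagonal d * diagonal (fun u => (d u)⁻¹) = 1 := by
    rw [← hDinv, mul_nonsing_inv _ hD]
  have hDiq : q ᵥ* diagonal (fun u => (d u)⁻¹) = b⁻¹ • q := by
    funext u
    rw [vecMul_diagonal, Pi.smul_apply, smul_eq_mul]
    have := hq u
    have := (hd u).ne'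
    field_simp
    linarith
  obtain ⟨z, hz⟩ : ∃ z, z = K⁻¹ *ᵥ (1 : E → ℝ) := ⟨_, rfl⟩
  have hKz : K *ᵥ z = 1 := by
    rw [hz, mulVec_mulVec, mul_nonsing_inv _ (Ne.isUnit hK), one_mulVec]
  -- An explicit solution: `Xᵀ q = -1` and `Xᵀ D⁻¹ X z = K z - z = 1 - z`, so all terms in the image
  -- of `X` cancel.
  have hNy : (diagonal d + X * Xᵀ) *ᵥ (q + diagonal (fun u => (d u)⁻¹) *ᵥ X *ᵥ z) = b • q := by
    have h1 : X *ᵥ Xᵀ *ᵥ diagonal (fun u => (d u)⁻¹) *ᵥ X *ᵥ z = X *ᵥ (1 - z) := by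
      rw [← hKz, hKdef, add_mulVec, one_mulVec, add_sub_cancel_left, ← mulVec_mulVec,
        ← mulVec_mulVec]
    rw [mulVec_add, add_mulVec, add_mulVec, hDq, ← mulVec_mulVec, ← mulVec_mulVec, hXq, h1,
      mulVec_mulVec, hDDi, one_mulVec, mulVec_neg, mulVec_sub]
    abel
  have hNq : (diagonal d + X * Xᵀ)⁻¹ *ᵥ q =
      b⁻¹ • (q + diagonal (fun u => (d u)⁻¹) *ᵥ X *ᵥ z) := by
    have h := congrArg (fun y => b⁻¹ • (diagonal d + X * Xᵀ)⁻¹ *ᵥ y) hNy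
    rw [mulVec_mulVec, nonsing_inv_mul _ (Ne.isUnit hN0), one_mulVec, mulVec_smul, smul_smul,
      inv_mul_cancel₀ hb.ne', one_smul] at h
    exact h.symm
  have hqX : q ᵥ* X = -1 := by rw [← mulVec_transpose, hXq]
  have hqz : q ⬝ᵥ (diagonal d + X * Xᵀ)⁻¹ *ᵥ q = 1 - (b ^ 2)⁻¹ * (1 ⬝ᵥ z) := by
    rw [hNq, dotProduct_smul, dotProduct_add, hqq, dotProduct_mulVec, hDiq, smul_dotProduct,
      dotProduct_mulVec, hqX, neg_dotProduct, smul_eq_mul, smul_eq_mul]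
    field_simp
    ring
  have hsub : diagonal d + X * Xᵀ - vecMulVec q q = diagonal d + X * Xᵀ + vecMulVec (-q) q := by
    rw [neg_vecMulVec, sub_eq_add_neg]
  rw [hsub, det_add_vecMulVec _ hN0, mulVec_neg, dotProduct_neg, hqz, hN, hz]
  field_simp
  ring

end Incidence

/-! ### Two cliques joined by arbitrary edges. -/

section CrossEdges

variable {V : Type*} [Fintype V] [DecidableEq V]

/-- The edges of `G` leaving `S`, oriented from `S` to its complement. -/
def crossEdges (G : SimpleGraph V) [DecidableRel G.Adj] (S : Finset V) : Finset (V × V) :=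
  {e | e.1 ∈ S ∧ e.2 ∉ S ∧ G.Adj e.1 e.2}

/-- The edges of `G` leaving `S` are pairwise disjoint. -/
def CrossMatching (G : SimpleGraph V) [DecidableRel G.Adj] (S : Finset V) : Prop :=
  ∀ e ∈ crossEdges G S, ∀ f ∈ crossEdges G S, e ≠ f → e.1 ≠ f.1 ∧ e.2 ≠ f.2

/-- The number of spanning trees of cliques of orders `a` and `b` joined by `r` disjoint edges. -/
noncomputable def joinedCliquesCount (a b r : ℕ) : ℝ :=
  r * ((a : ℝ) ^ (a - 2) * (b : ℝ) ^ (b - 2)) * (1 + 1 / (a : ℝ) + 1 / (b : ℝ)) ^ (r - 1)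

variable (G : SimpleGraph V) [DecidableRel G.Adj] (S : Finset V)

theorem mem_crossEdges {e : V × V} :
    e ∈ crossEdges G S ↔ e.1 ∈ S ∧ e.2 ∉ S ∧ G.Adj e.1 e.2 := by
  simp [crossEdges]

/-- The signed incidence matrix of the edges leaving `S`. -/
def crossIncidence : Matrix V (crossEdges G S) ℝ :=
  of fun u e => if u ∈ S then (if e.1.1 = u then 1 else 0) else (if e.1.2 = u then -1 else 0)

theorem crossIncidence_eq (u : V) (e : crossEdges G S) :
    crossIncidence G S u e = (if e.1.1 = u then 1 else 0) - (if e.1.2 = u then 1 else 0) := by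
  obtain ⟨h1, h2, -⟩ := (mem_crossEdges G S).1 e.2
  by_cases hu : u ∈ S
  · have : e.1.2 ≠ u := fun h => h2 (h ▸ hu)
    simp [crossIncidence, hu, this]
  · have : e.1.1 ≠ u := fun h => hu (h ▸ h1)
    simp only [crossIncidence, of_apply, hu, if_false, this]
    split_ifs <;> simp

theorem crossIncidence_transpose_mulVec_one : (crossIncidence G S)ᵀ *ᵥ 1 = 0 := by
  funext e
  simp [mulVec, dotProduct, crossIncidence_eq]

theorem crossIncidence_transpose_mulVec_indicator :
    (crossIncidence G S)ᵀ *ᵥ (fun u => if u ∈ S then 0 else 1) = -1 := by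
  funext e
  obtain ⟨h1, h2, -⟩ := (mem_crossEdges G S).1 e.2
  simp only [mulVec, dotProduct, transpose_apply, crossIncidence_eq, sub_mul, sum_sub_distrib,
    ite_mul, one_mul, zero_mul, sum_ite_eq, mem_univ, if_true, h1, h2, if_false, Pi.neg_apply,
    Pi.one_apply, zero_sub]

/-- For `x = 1/a` and `y = 1/b` this makes sharing an endpoint visible as a positive off-diagonal
entry. No mixed term occurs, because first endpoints lie in `S` and second endpoints outside. -/
theorem crossIncidence_gram (x y : ℝ) (e f : crossEdges G S) :
    ((crossIncidence G S)ᵀ * diagonal (fun u => if u ∈ S then x else y) * crossIncidence G S) e f =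
      (if e.1.1 = f.1.1 then x else 0) + (if e.1.2 = f.1.2 then y else 0) := by
  have h : ∀ u, (crossIncidence G S) u e * (if u ∈ S then x else y) * (crossIncidence G S) u f =
      (if e.1.1 = u then (if f.1.1 = u then x else 0) else 0) +
        (if e.1.2 = u then (if f.1.2 = u then y else 0) else 0) := by
    intro u
    obtain ⟨h1, h2, -⟩ := (mem_crossEdges G S).1 e.2
    by_cases hu : u ∈ S
    · have : e.1.2 ≠ u := fun h => h2 (h ▸ hu)
      simp [crossIncidence, hu, this]
      split_ifs <;> simp
    · have : e.1.1 ≠ u := fun h => hu (h ▸ h1)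
      simp [crossIncidence, hu, this]
      split_ifs <;> simp
  rw [mul_apply]
  simp only [mul_diagonal, transpose_apply, h, sum_add_distrib, sum_ite_eq, mem_univ, if_true]
  simp only [eq_comm]

theorem crossIncidence_mul_transpose {u w : V} (huw : u ≠ w) :
    (crossIncidence G S * (crossIncidence G S)ᵀ) u w =
      if (u ∈ S ↔ w ∈ S) then 0 else if G.Adj u w then -1 else 0 := by
  rw [mul_apply]
  simp only [transpose_apply]
  by_cases hu : u ∈ S <;> by_cases hw : w ∈ S
  · rw [if_pos (by simp [hu, hw])]
    refine sum_eq_zero fun e _ => ?_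
    simp only [crossIncidence, of_apply, hu, hw, if_true]
    split_ifs with h1 h2
    · exact absurd (h1.symm.trans h2) huw
    all_goals simp
  · rw [if_neg (by simp [hu, hw])]
    have h : ∀ e : crossEdges G S, crossIncidence G S u e * crossIncidence G S w e =
        if e.1 = (u, w) then -1 else 0 := by
      intro e
      simp only [crossIncidence, of_apply, hu, hw, if_true, if_false, Prod.ext_iff]
      split_ifs <;> simp_all
    rw [sum_congr rfl fun e _ => h e,
      sum_coe_sort (crossEdges G S) (fun e => if e = (u, w) then (-1 : ℝ) else 0), sum_ite_eq']
    simp [mem_crossEdges, hu, hw]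
  · rw [if_neg (by simp [hu, hw])]
    have h : ∀ e : crossEdges G S, crossIncidence G S u e * crossIncidence G S w e =
        if e.1 = (w, u) then -1 else 0 := by
      intro e
      simp only [crossIncidence, of_apply, hu, hw, if_true, if_false, Prod.ext_iff]
      split_ifs <;> simp_all
    rw [sum_congr rfl fun e _ => h e,
      sum_coe_sort (crossEdges G S) (fun e => if e = (w, u) then (-1 : ℝ) else 0), sum_ite_eq']
    simp [mem_crossEdges, hu, hw, G.adj_comm]
  · rw [if_pos (by simp [hu, hw])]
    refine sum_eq_zero fun e _ => ?_
    simp only [crossIncidence, of_apply, hu, hw, if_false]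
    split_ifs with h1 h2
    · exact absurd (h1.symm.trans h2) huw
    all_goals simp

/-- Suited to Laplacians: the row sums determine the diagonal once the other entries are known. -/
theorem ext_of_mulVec_one {A B : Matrix V V ℝ} (hoff : ∀ u w, u ≠ w → A u w = B u w)
    (hone : A *ᵥ 1 = B *ᵥ 1) : A = B := by
  ext u w
  by_cases huw : u = w
  · subst huw
    have h := congrFun hone u
    simp only [mulVec, dotProduct, Pi.one_apply, mul_one] at h
    rw [← add_sum_erase _ _ (mem_univ u), ← add_sum_erase _ _ (mem_univ u),
      sum_congr rfl fun x hx => hoff u x (ne_of_mem_erase hx).symm] at h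
    exact add_right_cancel h
  · exact hoff u w huw

theorem sum_ite_mem_zero_one (S : Finset V) :
    (∑ x, if x ∈ S then (0 : ℝ) else 1) = #Sᶜ := by
  rw [sum_ite, sum_const_zero, zero_add, sum_const, nsmul_eq_mul, mul_one]
  congr 2
  ext
  simp

/-- A clique on `S` has Laplacian `#S • 1` minus the all-ones matrix, and likewise for `Sᶜ`; the cut
edges contribute `X * Xᵀ`. Perturbing by the indicator of `S` cancels one of the two all-ones blocks
and leaves a single rank-one correction. -/
theorem lapMatrix_eq_of_full (hfull : ∀ u w, u ≠ w → (u ∈ S ↔ w ∈ S) → G.Adj u w) :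
    G.lapMatrix ℝ + vecMulVec (fun u => if u ∈ S then 1 else 0) (fun u => if u ∈ S then 1 else 0) =
      diagonal (fun u => if u ∈ S then (#S : ℝ) else #Sᶜ) +
        crossIncidence G S * (crossIncidence G S)ᵀ -
        vecMulVec (fun u => if u ∈ S then 0 else 1) (fun u => if u ∈ S then 0 else 1) := by
  rw [eq_sub_iff_add_eq]
  refine ext_of_mulVec_one (fun u w huw => ?_) ?_
  · rw [Matrix.add_apply, Matrix.add_apply, Matrix.add_apply, crossIncidence_mul_transpose G S huw,
      diagonal_apply_ne _ huw]
    simp only [SimpleGraph.lapMatrix, SimpleGraph.degMatrix, Matrix.sub_apply, diagonal_apply_ne _ huw,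
      SimpleGraph.adjMatrix_apply, vecMulVec_apply]
    have := hfull u w huw
    by_cases hu : u ∈ S <;> by_cases hw : w ∈ S <;> simp_all
    all_goals split_ifs <;> simp
  · have hL : G.lapMatrix ℝ *ᵥ 1 = 0 := G.lapMatrix_mulVec_const_eq_zero
    rw [add_mulVec, add_mulVec, add_mulVec, hL, ← mulVec_mulVec,
      crossIncidence_transpose_mulVec_one, mulVec_zero, add_zero, zero_add]
    funext u
    have hcompl : (∑ x, if x ∈ S then (0 : ℝ) else 1) = #Sᶜ := sum_ite_mem_zero_one S
    by_cases hu : u ∈ S <;>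
      simp [mulVec, dotProduct, vecMulVec_apply, hu, hcompl, diagonal_apply]

theorem numSpanningTrees_le_of_full (hfull : ∀ u w, u ≠ w → (u ∈ S ↔ w ∈ S) → G.Adj u w)
    (ha : 2 ≤ #S) (hb : 2 ≤ #Sᶜ) (hr : (crossEdges G S).Nonempty) :
    (numSpanningTrees G : ℝ) ≤ joinedCliquesCount #S #Sᶜ #(crossEdges G S) ∧
      ((numSpanningTrees G : ℝ) = joinedCliquesCount #S #Sᶜ #(crossEdges G S) ↔
        CrossMatching G S) := by
  have hapos : (0 : ℝ) < #S := by exact_mod_cast (by omega : 0 < #S)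
  have hbpos : (0 : ℝ) < #Sᶜ := by exact_mod_cast (by omega : 0 < #Sᶜ)
  obtain ⟨v, hv⟩ : S.Nonempty := card_pos.1 (by omega)
  have : Nonempty V := ⟨v⟩
  have : Nonempty (crossEdges G S) := hr.to_subtype
  set d : V → ℝ := fun u => if u ∈ S then (#S : ℝ) else #Sᶜ with hd
  have hdpos : ∀ u, 0 < d u := fun u => by
    rw [hd]
    dsimp only
    split_ifs <;> assumption
  set X := crossIncidence G S with hX
  set K := 1 + Xᵀ * diagonal (fun u => (d u)⁻¹) * X with hK
  have hdinv : (fun u => (d u)⁻¹) = fun u => if u ∈ S then (#S : ℝ)⁻¹ else (#Sᶜ : ℝ)⁻¹ := by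
    funext u
    rw [hd]
    dsimp only
    split_ifs <;> rfl
  have hKapply : ∀ e f, K e f = (if e = f then 1 else 0) +
      ((if e.1.1 = f.1.1 then (#S : ℝ)⁻¹ else 0) + (if e.1.2 = f.1.2 then (#Sᶜ : ℝ)⁻¹ else 0)) := by
    intro e f
    rw [hK, hdinv, Matrix.add_apply, crossIncidence_gram, one_apply]
  have hKpos : K.PosDef := by
    refine PosDef.one.add_posSemidef ?_
    have := (PosSemidef.diagonal fun u => (inv_pos.2 (hdpos u)).le).conjTranspose_mul_mul_same X
    rwa [conjTranspose_eq_transpose_of_trivial] at this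
  have hmain := det_mul_sum_inv_le hKpos (c := 1 + 1 / (#S : ℝ) + 1 / (#Sᶜ : ℝ)) (by positivity)
    (fun e => by rw [hKapply]; simp [add_assoc])
    (fun e f => by rw [hKapply]; split_ifs <;> positivity)
  have htau := det_lapMatrix_add_vecMulVec G (fun u => if u ∈ S then 1 else 0)
  have hdet := det_diagonal_add_sub_vecMulVec hdpos X (q := fun u => if u ∈ S then 0 else 1) hbpos
    (fun u => by rw [hd]; dsimp only; split_ifs <;> simp) ?_
    (crossIncidence_transpose_mulVec_indicator G S) hKpos.det_pos.ne'
  swap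
  · rw [← sum_ite_mem_zero_one S, dotProduct]
    exact sum_congr rfl fun u _ => by split_ifs <;> simp
  rw [← lapMatrix_eq_of_full G S hfull, htau] at hdet
  have hprod : ∏ u, d u = (#S : ℝ) ^ #S * (#Sᶜ : ℝ) ^ #Sᶜ := by
    rw [← prod_mul_prod_compl S]
    congr 1
    · exact prod_eq_pow_card fun u hu => if_pos hu
    · exact prod_eq_pow_card fun u hu => if_neg (mem_compl.1 hu)
  have hsum : (∑ u, if u ∈ S then (1 : ℝ) else 0) = #S := by simp
  set Φ := K.det * (1 ⬝ᵥ K⁻¹ *ᵥ 1) with hΦ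
  set A := (#S : ℝ) ^ (#S - 2) * (#Sᶜ : ℝ) ^ (#Sᶜ - 2) with hA
  have hApos : 0 < A := by positivity
  -- Kirchhoff gives the factor `#S ^ 2` and the edge reduction `#Sᶜ ^ 2`; both cancel against `∏ u,
  -- d u`, which produces the exponents `#S - 2` and `#Sᶜ - 2`.
  have hτ : (numSpanningTrees G : ℝ) = A * Φ := by
    have h1 : (#S : ℝ) ^ #S = #S ^ (#S - 2) * #S ^ 2 := by rw [← pow_add, Nat.sub_add_cancel ha]
    have h2 : (#Sᶜ : ℝ) ^ #Sᶜ = #Sᶜ ^ (#Sᶜ - 2) * #Sᶜ ^ 2 := by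
      rw [← pow_add, Nat.sub_add_cancel hb]
    rw [hprod, hsum, h1, h2] at hdet
    have h3 : ((#S : ℝ) ^ 2 * (#Sᶜ : ℝ) ^ 2) ≠ 0 := by positivity
    refine mul_left_cancel₀ h3 ?_
    rw [hA]
    linarith
  rw [Fintype.card_coe] at hmain
  have hcount : joinedCliquesCount #S #Sᶜ #(crossEdges G S) = A * (#(crossEdges G S) *
      (1 + 1 / (#S : ℝ) + 1 / (#Sᶜ : ℝ)) ^ (#(crossEdges G S) - 1)) := by
    rw [joinedCliquesCount, hA]
    ring
  rw [hτ, hcount, mul_le_mul_iff_right₀ hApos, mul_right_inj' hApos.ne', hmain.2]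
  refine ⟨hmain.1, ?_⟩
  constructor
  · intro h e he f hf hef
    have h1 := h ⟨e, he⟩ ⟨f, hf⟩ (by simpa using hef)
    rw [hKapply, if_neg (by simpa using hef), zero_add] at h1
    have h3 := inv_pos.2 hapos
    have h4 := inv_pos.2 hbpos
    constructor <;> intro h2
    · rw [if_pos h2] at h1
      split_ifs at h1 <;> linarith
    · rw [if_pos h2] at h1
      split_ifs at h1 <;> linarith
  · intro h e f hef
    obtain ⟨h1, h2⟩ := h e e.2 f f.2 fun h => hef (Subtype.ext h)
    rw [hKapply, if_neg hef, if_neg h1, if_neg h2]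
    simp

end CrossEdges

/-! ### Comparing clique sizes with a fixed sum. -/

section Numeric

theorem strictConvexOn_sub_two_mul_log :
    StrictConvexOn ℝ (Set.Ioi 0) fun x : ℝ => x * Real.log x + -(2 * Real.log x) := by
  refine (Real.strictConvexOn_mul_log.subset Set.Ioi_subset_Ici_self (convex_Ioi 0)).add_convexOn ?_
  exact (strictConcaveOn_log_Ioi.concaveOn.smul (zero_le_two (α := ℝ))).neg

/-- `x` and `y` are convex combinations of `a` and `b` with exchanged weights; add the two convexity
inequalities. -/
theorem _root_.StrictConvexOn.add_lt_add_of_mem_Ioo {s : Set ℝ} {g : ℝ → ℝ}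
    (hg : StrictConvexOn ℝ s g) {a b x y : ℝ} (ha : a ∈ s) (hb : b ∈ s) (hbx : b < x)
    (hxa : x < a) (hsum : x + y = a + b) : g x + g y < g a + g b := by
  have hab : 0 < a - b := by linarith
  have h1 := hg.2 ha hb (by linarith) (div_pos (sub_pos.2 hbx) hab) (div_pos (sub_pos.2 hxa) hab)
    (by field_simp; ring)
  have h2 := hg.2 ha hb (by linarith) (div_pos (sub_pos.2 hxa) hab) (div_pos (sub_pos.2 hbx) hab)
    (by field_simp; ring)
  have e1 : ((x - b) / (a - b)) • a + ((a - x) / (a - b)) • b = x := by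
    simp only [smul_eq_mul]
    field_simp
    ring
  have e2 : ((a - x) / (a - b)) • a + ((x - b) / (a - b)) • b = y := by
    obtain rfl : y = a + b - x := by linarith
    simp only [smul_eq_mul]
    field_simp
    ring
  rw [e1] at h1
  rw [e2] at h2
  have e3 : (x - b) / (a - b) = 1 - (a - x) / (a - b) := by
    field_simp
    ring
  rw [e3] at h1 h2
  simp only [smul_eq_mul] at h1 h2
  linarith

theorem log_pow_sub_two {a : ℕ} (ha : 2 ≤ a) :
    Real.log ((a : ℝ) ^ (a - 2)) = a * Real.log a + -(2 * Real.log a) := by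
  rw [Real.log_pow, Nat.cast_sub ha]
  push_cast
  ring

/-- The logarithm of the clique factor is a sum of values of the strictly convex `x log x - 2 log
x`, so less balanced sizes increase it. They also do not decrease `1/a + 1/b = (a + b)/(a b)`, as
the product is smaller. -/
theorem joinedCliquesCount_lt {a b a' b' r : ℕ} (hr : 0 < r) (hb : 2 ≤ b) (hbb : b < b')
    (hba : b' ≤ a') (hsum : a' + b' = a + b) :
    joinedCliquesCount a' b' r < joinedCliquesCount a b r := by
  have hbR : (2 : ℝ) ≤ b := by exact_mod_cast hb
  have hbbR : (b : ℝ) < b' := by exact_mod_cast hbb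
  have hbaR : (b' : ℝ) ≤ a' := by exact_mod_cast hba
  have hsumR : (a' : ℝ) + b' = a + b := by exact_mod_cast hsum
  have hb0 : (0 : ℝ) < b := by linarith
  have hb'0 : (0 : ℝ) < b' := by linarith
  have ha'0 : (0 : ℝ) < a' := by linarith
  have ha0 : (0 : ℝ) < a := by linarith
  have h1 : (a' : ℝ) ^ (a' - 2) * (b' : ℝ) ^ (b' - 2) < (a : ℝ) ^ (a - 2) * (b : ℝ) ^ (b - 2) := by
    rw [← Real.log_lt_log_iff (by positivity) (by positivity),
      Real.log_mul (by positivity) (by positivity), Real.log_mul (by positivity) (by positivity),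
      log_pow_sub_two (by omega), log_pow_sub_two (by omega), log_pow_sub_two (by omega),
      log_pow_sub_two hb]
    exact strictConvexOn_sub_two_mul_log.add_lt_add_of_mem_Ioo (Set.mem_Ioi.2 ha0)
      (Set.mem_Ioi.2 hb0) (by linarith) (by linarith) hsumR
  have h2 : 1 + 1 / (a' : ℝ) + 1 / (b' : ℝ) ≤ 1 + 1 / (a : ℝ) + 1 / (b : ℝ) := by
    have e1 : 1 / (a' : ℝ) + 1 / (b' : ℝ) = (a + b) / (a' * b') := by
      rw [← hsumR]
      field_simp
      ring
    have e2 : 1 / (a : ℝ) + 1 / (b : ℝ) = (a + b) / (a * b) := by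
      field_simp
      ring
    rw [add_assoc, add_assoc, e1, e2]
    gcongr 1 + (_ / ?_)
    nlinarith
  rw [joinedCliquesCount, joinedCliquesCount]
  have hr0 : (0 : ℝ) < r := by exact_mod_cast hr
  have h3 : (1 + 1 / (a' : ℝ) + 1 / (b' : ℝ)) ^ (r - 1) ≤
      (1 + 1 / (a : ℝ) + 1 / (b : ℝ)) ^ (r - 1) := by gcongr
  exact mul_lt_mul (mul_lt_mul_of_pos_left h1 hr0) h3 (by positivity) (by positivity)

/-- Clearing the denominator `(a b)^(r-1)` uses up `r - 1` factors of each power; the size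
hypotheses keep the truncated exponents honest. -/
theorem joinedCliquesCount_eq_cast {a b r : ℕ} (hr : 0 < r) (ha : r + 1 ≤ a) (hb : r + 1 ≤ b) :
    joinedCliquesCount a b r = ((r * b ^ (b - 1 - r) * a ^ (a - 1 - r) *
      (b * a + (a + b)) ^ (r - 1) : ℕ) : ℝ) := by
  have ha0 : (0 : ℝ) < a := by exact_mod_cast (by omega : 0 < a)
  have hb0 : (0 : ℝ) < b := by exact_mod_cast (by omega : 0 < b)
  have h1 : 1 + 1 / (a : ℝ) + 1 / (b : ℝ) = (b * a + (a + b)) / (b * a) := by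
    field_simp
    ring
  have h2 : (a : ℝ) ^ (a - 2) = a ^ (a - 1 - r) * a ^ (r - 1) := by
    rw [← pow_add]
    congr 1
    omega
  have h3 : (b : ℝ) ^ (b - 2) = b ^ (b - 1 - r) * b ^ (r - 1) := by
    rw [← pow_add]
    congr 1
    omega
  rw [joinedCliquesCount, h1, h2, h3, div_pow, mul_pow]
  push_cast
  field_simp

end Numeric

/-! ### Vertex bipartitions behind minimum edge cuts. -/

section Cuts

/-- The graph obtained from `G` by making `S` and its complement cliques. -/
def fillSides {V : Type*} (G : SimpleGraph V) (S : Finset V) : SimpleGraph V where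
  Adj u w := u ≠ w ∧ ((u ∈ S ↔ w ∈ S) ∨ G.Adj u w)
  symm := ⟨fun _ _ h => ⟨h.1.symm, h.2.imp Iff.symm G.adj_symm⟩⟩
  loopless := ⟨fun _ h => h.1 rfl⟩

theorem le_fillSides {V : Type*} (G : SimpleGraph V) (S : Finset V) : G ≤ fillSides G S :=
  fun _ _ h => ⟨h.ne, Or.inr h⟩

theorem _root_.SimpleGraph.Reachable.induct_adj {V : Type*} {G : SimpleGraph V} {P : V → Prop}
    (hstep : ∀ u w, G.Adj u w → P u → P w) {x y : V} (h : G.Reachable x y) (hx : P x) : P y := by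
  obtain ⟨p⟩ := h
  induction p with
  | nil => exact hx
  | cons hadj _ ih => exact ih (hstep _ _ hadj hx)

variable {V : Type*} [Fintype V] [DecidableEq V] (G : SimpleGraph V) [DecidableRel G.Adj] (S : Finset V)

theorem ncard_crossEdges_image :
    ((fun e : V × V => s(e.1, e.2)) '' (crossEdges G S : Set (V × V))).ncard =
      #(crossEdges G S) := by
  rw [Set.InjOn.ncard_image, Set.ncard_coe_finset]
  intro e he f hf hef
  have he := (mem_crossEdges G S).1 he
  have hf := (mem_crossEdges G S).1 hf
  rcases Sym2.eq_iff.1 hef with ⟨h1, h2⟩ | ⟨h1, h2⟩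
  · exact Prod.ext h1 h2
  · exact absurd (h1 ▸ he.1) hf.2.1

theorem isEdgeCut_crossEdges_image (hS : S.Nonempty) (hSc : Sᶜ.Nonempty) :
    IsEdgeCut G ((fun e : V × V => s(e.1, e.2)) '' (crossEdges G S : Set (V × V))) := by
  refine ⟨?_, fun hconn => ?_⟩
  · rintro _ ⟨e, he, rfl⟩
    exact ((mem_crossEdges G S).1 he).2.2
  · obtain ⟨x, hx⟩ := hS
    obtain ⟨y, hy⟩ := hSc
    refine mem_compl.1 hy ((hconn x y).induct_adj (P := fun u => u ∈ S) (fun u w huw hu => ?_) hx)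
    rw [SimpleGraph.deleteEdges_adj] at huw
    by_contra hw
    exact huw.2 ⟨(u, w), (mem_crossEdges G S).2 ⟨hu, hw, huw.1⟩, rfl⟩

theorem edgeConnectivity_le_card_crossEdges (hS : S.Nonempty) (hSc : Sᶜ.Nonempty) :
    edgeConnectivity G ≤ #(crossEdges G S) :=
  Nat.sInf_le ⟨_, isEdgeCut_crossEdges_image G S hS hSc, ncard_crossEdges_image G S⟩

theorem connected_of_edgeConnectivity_pos (h : 0 < edgeConnectivity G) : G.Connected := by
  by_contra hG
  have : edgeConnectivity G ≤ 0 :=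
    Nat.sInf_le ⟨∅, ⟨Set.empty_subset _, by rwa [SimpleGraph.deleteEdges_empty]⟩, Set.ncard_empty _⟩
  omega

/-- For a minimum cut `U`, let `S` be a component of `G - U`. Every edge leaving `S` lies in `U`,
and these edges already form a cut. -/
theorem exists_card_crossEdges_eq_edgeConnectivity [Nonempty V] (h : 0 < edgeConnectivity G) :
    ∃ S : Finset V, S.Nonempty ∧ Sᶜ.Nonempty ∧ #(crossEdges G S) = edgeConnectivity G := by
  classical
  -- Positivity excludes the default value `sInf ∅ = 0`, so the minimum is attained.
  have hne : {k : ℕ | ∃ U : Set (Sym2 V), IsEdgeCut G U ∧ U.ncard = k}.Nonempty :=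
    Nat.nonempty_of_pos_sInf h
  obtain ⟨U, ⟨-, hU⟩, hUr⟩ := Nat.sInf_mem hne
  have hpre : ¬ (G.deleteEdges U).Preconnected := fun hp => hU ⟨hp⟩
  obtain ⟨x, hx⟩ := not_forall.1 hpre
  obtain ⟨y, hxy⟩ := not_forall.1 hx
  let S : Finset V := {u | (G.deleteEdges U).Reachable x u}
  have hmem : ∀ u, u ∈ S ↔ (G.deleteEdges U).Reachable x u := fun u => by simp [S]
  have hS : S.Nonempty := ⟨x, (hmem x).2 SimpleGraph.Reachable.rfl⟩
  have hSc : Sᶜ.Nonempty := ⟨y, mem_compl.2 fun hy => hxy ((hmem y).1 hy)⟩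
  refine ⟨S, hS, hSc, le_antisymm ?_ (edgeConnectivity_le_card_crossEdges G S hS hSc)⟩
  rw [← ncard_crossEdges_image, edgeConnectivity, ← hUr]
  refine Set.ncard_le_ncard ?_ (Set.toFinite _)
  rintro _ ⟨⟨u, w⟩, he, rfl⟩
  obtain ⟨h1, h2, h3⟩ := (mem_crossEdges G S).1 he
  by_contra hU'
  refine h2 ((hmem w).2 (((hmem u).1 h1).trans (SimpleGraph.Adj.reachable ?_)))
  rw [SimpleGraph.deleteEdges_adj]
  exact ⟨h3, hU'⟩

theorem mem_crossEdges_compl {e : V × V} : e ∈ crossEdges G Sᶜ ↔ e.swap ∈ crossEdges G S := by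
  simp only [mem_crossEdges, mem_compl, not_not, Prod.fst_swap, Prod.snd_swap, G.adj_comm]
  tauto

theorem card_crossEdges_compl : #(crossEdges G Sᶜ) = #(crossEdges G S) := by
  refine card_bij' (fun e _ => e.swap) (fun e _ => e.swap)
    (fun e he => (mem_crossEdges_compl G S).1 he)
    (fun e he => (mem_crossEdges_compl G S).2 (by simpa using he)) ?_ ?_ <;> simp

/-- A nonempty set left by fewer than `G.minDegree` edges has more than `G.minDegree` vertices. -/
theorem minDegree_lt_card (hS : S.Nonempty) (h : #(crossEdges G S) < G.minDegree) :
    G.minDegree < #S := by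
  by_contra! hle
  -- At most `#S - 1` neighbours of `u` lie in `S`; the others use edges leaving `S`.
  have hfib : ∀ u ∈ S, G.minDegree - (#S - 1) ≤ #{e ∈ crossEdges G S | e.1 = u} := by
    intro u hu
    have h1 : G.neighborFinset u ⊆
        (S.erase u) ∪ ({e ∈ crossEdges G S | e.1 = u} : Finset (V × V)).image Prod.snd := by
      intro w hw
      rw [SimpleGraph.mem_neighborFinset] at hw
      rw [mem_union, mem_erase, mem_image]
      by_cases hwS : w ∈ S
      · exact Or.inl ⟨hw.ne', hwS⟩
      · exact Or.inr ⟨(u, w), mem_filter.2 ⟨(mem_crossEdges G S).2 ⟨hu, hwS, hw⟩, rfl⟩, rfl⟩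
    have h2 := (card_le_card h1).trans (card_union_le _ _)
    have h3 : #(({e ∈ crossEdges G S | e.1 = u} : Finset (V × V)).image Prod.snd) ≤ _ :=
      card_image_le
    rw [SimpleGraph.card_neighborFinset_eq_degree, card_erase_of_mem hu] at h2
    have h4 := G.minDegree_le_degree u
    omega
  have hsum : #S * (G.minDegree - (#S - 1)) ≤ #(crossEdges G S) := by
    rw [card_eq_sum_card_fiberwise (f := Prod.fst) (t := S)
      fun e he => ((mem_crossEdges G S).1 he).1, ← smul_eq_mul]
    exact card_nsmul_le_sum _ _ _ hfib
  have hpos := hS.card_pos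
  obtain ⟨k, hk⟩ := Nat.exists_eq_add_of_le hle
  obtain ⟨m, hm⟩ := Nat.exists_eq_add_of_le hpos
  have h5 : G.minDegree - (#S - 1) = k + 1 := by omega
  rw [h5] at hsum
  -- With `#S = m + 1` and `G.minDegree = #S + k`, the two sides differ by `m * k`.
  have h6 : G.minDegree ≤ #S * (k + 1) := by
    rw [hk, hm]
    nlinarith [Nat.zero_le (m * k)]
  omega

instance : DecidableRel (fillSides G S).Adj :=
  fun u w => inferInstanceAs (Decidable (u ≠ w ∧ ((u ∈ S ↔ w ∈ S) ∨ G.Adj u w)))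

theorem crossEdges_fillSides : crossEdges (fillSides G S) S = crossEdges G S := by
  ext ⟨u, w⟩
  rw [mem_crossEdges, mem_crossEdges]
  refine and_congr_right fun hu => and_congr_right fun hw => ?_
  refine ⟨fun h => h.2.resolve_left fun h' => hw (h'.1 hu), fun h => le_fillSides G S h⟩

end Cuts

/-! ### Adding edges and counting spanning trees. -/

section Monotonicity

variable {V : Type*} [Finite V]

theorem numSpanningTrees_mono {G H : SimpleGraph V} (h : G ≤ H) :
    numSpanningTrees G ≤ numSpanningTrees H :=
  Set.ncard_le_ncard (fun _ hT => ⟨hT.1.trans h, hT.2⟩) (Set.toFinite _)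

/-- Every edge of a connected graph extends to a spanning tree. Equal counts make all spanning trees
of `H` spanning trees of `G`, so each edge of `H` is in `G`. Connectedness matters: otherwise both
counts could be zero. -/
theorem eq_of_numSpanningTrees_eq {G H : SimpleGraph V} (hG : G.Connected) (h : G ≤ H)
    (heq : numSpanningTrees G = numSpanningTrees H) : G = H := by
  refine le_antisymm h fun u w huw => ?_
  have hset : {T : SimpleGraph V | T ≤ G ∧ T.IsTree} = {T | T ≤ H ∧ T.IsTree} :=
    Set.eq_of_subset_of_ncard_le (fun _ hT => ⟨hT.1.trans h, hT.2⟩) heq.ge (Set.toFinite _)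
  have hacyc : (⊥ ⊔ SimpleGraph.edge u w : SimpleGraph V).IsAcyclic := by
    refine SimpleGraph.IsAcyclic.sup_edge_of_not_reachable ?_ SimpleGraph.isAcyclic_bot
    rw [SimpleGraph.reachable_bot]
    exact huw.ne
  rw [bot_sup_eq] at hacyc
  have hle : SimpleGraph.edge u w ≤ H := (SimpleGraph.edge_le_iff _).2 (Or.inr huw)
  obtain ⟨T, hET, hTH, hT⟩ := (hG.mono h).exists_isTree_le_of_le_of_isAcyclic hle hacyc
  have hTG : T ∈ {T : SimpleGraph V | T ≤ G ∧ T.IsTree} := hset ▸ ⟨hTH, hT⟩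
  exact hTG.1 (hET ((SimpleGraph.edge_adj u w u w).2 ⟨by simp, huw.ne⟩))

end Monotonicity

/-! ### Recognising the extremal graph. -/

section Isomorphism

variable {V : Type*} [Fintype V] [DecidableEq V] (G : SimpleGraph V) [DecidableRel G.Adj]

theorem nonempty_iso_joinedCliques {S : Finset V} {a b r : ℕ}
    (hfull : ∀ u w, u ≠ w → (u ∈ S ↔ w ∈ S) → G.Adj u w) (ha : #S = a) (hb : #Sᶜ = b)
    (hr : #(crossEdges G S) = r) (hra : r ≤ a) (hrb : r ≤ b) (hM : CrossMatching G S) :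
    Nonempty (G ≃g joinedCliques a b r) := by
  obtain ⟨ε⟩ : Nonempty (Fin r ≃ crossEdges G S) := ⟨(crossEdges G S).equivFinOfCardEq hr |>.symm⟩
  have hmem : ∀ i, (ε i : V × V).1 ∈ S ∧ (ε i : V × V).2 ∉ S ∧
      G.Adj (ε i : V × V).1 (ε i : V × V).2 := fun i => (mem_crossEdges G S).1 (ε i).2
  have hinj : ∀ i j, ((ε i : V × V).1 = (ε j : V × V).1 ∨ (ε i : V × V).2 = (ε j : V × V).2) →
      i = j := by
    intro i j h
    by_contra hij
    have := hM _ (ε i).2 _ (ε j).2 fun h' => hij (ε.injective (Subtype.ext h'))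
    tauto
  -- On each side, the first `r` labels go to the endpoints of the enumerated cut edges, distinct
  -- because the cut is a matching, and the remaining labels are filled in arbitrarily. Using one
  -- enumeration `ε` for both sides matches the labels across the cut.
  have extend : ∀ (m : ℕ) (t : Finset V) (c : V × V → V), #t = m → r ≤ m →
      (∀ i, c (ε i) ∈ t) → (∀ i j, c (ε i) = c (ε j) → i = j) →
      ∃ g : Fin m ≃ t, ∀ i : Fin m, ∀ hi : (i : ℕ) < r, (g i : V) = c (ε ⟨i, hi⟩) := by
    intro m t c htm hrm hct hcinj
    rcases Nat.eq_zero_or_pos m with rfl | hm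
    · have : IsEmpty t := by
        rw [card_eq_zero] at htm
        subst htm
        infer_instance
      exact ⟨Equiv.equivOfIsEmpty _ _, fun i => i.elim0⟩
    obtain ⟨v, -⟩ : t.Nonempty := card_pos.1 (htm ▸ hm)
    obtain ⟨g, hg⟩ := Finset.exists_equiv_extend_of_card_eq (α := Fin m) (t := t)
      (s := {i | (i : ℕ) < r})
      (f := fun i => if hi : (i : ℕ) < r then c (ε ⟨i, hi⟩) else v) (by simp [htm])
      (by
        intro x hx
        obtain ⟨i, hi, rfl⟩ := mem_image.1 hx
        have hi : (i : ℕ) < r := by simpa using hi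
        rw [dif_pos hi]
        exact hct _)
      (by
        intro i hi j hj hij
        have hi : (i : ℕ) < r := by simpa using hi
        have hj : (j : ℕ) < r := by simpa using hj
        dsimp only at hij
        rw [dif_pos hi, dif_pos hj] at hij
        exact Fin.ext (congrArg (fun k : Fin r => (k : ℕ)) (hcinj _ _ hij)))
    exact ⟨g, fun i hi => (hg i (by simpa using hi)).trans (dif_pos hi)⟩
  obtain ⟨gL, hgL⟩ := extend a S Prod.fst ha hra (fun i => (hmem i).1)
    fun i j h => hinj i j (Or.inl h)
  obtain ⟨gR, hgR⟩ := extend b Sᶜ Prod.snd hb hrb (fun i => mem_compl.2 (hmem i).2.1)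
    fun i j h => hinj i j (Or.inr h)
  have hLS : ∀ i, (gL i : V) ∈ S := fun i => (gL i).2
  have hRS : ∀ j, (gR j : V) ∉ S := fun j => mem_compl.1 (gR j).2
  let ψ : Fin a ⊕ Fin b → V := Sum.elim (fun i => gL i) (fun j => gR j)
  have hψ : Function.Bijective ψ := by
    constructor
    · rintro (i | i) (j | j) h
      · exact congrArg _ (gL.injective (Subtype.ext h))
      · exact absurd (show (gL i : V) = gR j from h) fun h => hRS j (h ▸ hLS i)
      · exact absurd (show (gR i : V) = gL j from h) fun h => hRS i (h ▸ hLS j)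
      · exact congrArg _ (gR.injective (Subtype.ext h))
    · intro v
      by_cases hv : v ∈ S
      · exact ⟨Sum.inl (gL.symm ⟨v, hv⟩), by simp [ψ]⟩
      · exact ⟨Sum.inr (gR.symm ⟨v, mem_compl.2 hv⟩), by simp [ψ]⟩
  have hcross : ∀ i j, G.Adj (gL i) (gR j) ↔ (i : ℕ) = (j : ℕ) ∧ (i : ℕ) < r := by
    intro i j
    constructor
    · intro h
      obtain ⟨k, hk⟩ := ε.surjective ⟨(gL i, gR j), (mem_crossEdges G S).2 ⟨hLS i, hRS j, h⟩⟩
      have h1 : (ε k : V × V).1 = gL i := by rw [hk]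
      have h2 : (ε k : V × V).2 = gR j := by rw [hk]
      have h3 := hgL ⟨k, k.2.trans_le hra⟩ k.2
      have h4 := hgR ⟨k, k.2.trans_le hrb⟩ k.2
      have h5 := Fin.ext_iff.1 (gL.injective (Subtype.ext (h3.trans h1)))
      have h6 := Fin.ext_iff.1 (gR.injective (Subtype.ext (h4.trans h2)))
      have := k.2
      simp only at h5 h6
      omega
    · rintro ⟨hij, hi⟩
      rw [hgL i hi, hgR j (hij ▸ hi)]
      have : (⟨j, hij ▸ hi⟩ : Fin r) = ⟨i, hi⟩ := Fin.ext hij.symm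
      rw [this]
      exact (hmem _).2.2
  refine ⟨RelIso.symm ⟨Equiv.ofBijective ψ hψ, ?_⟩⟩
  have hne : ∀ x y, G.Adj (ψ x) (ψ y) → x ≠ y := by
    rintro x _ h rfl
    exact h.ne rfl
  rintro (i | i) (j | j)
  · refine ⟨fun h e => hne (.inl i) (.inl j) h (congrArg _ e),
      fun h => hfull _ _ (fun e => h ?_) ?_⟩
    · exact Sum.inl_injective (hψ.1 e)
    · exact iff_of_true (hLS i) (hLS j)
  · exact hcross i j
  · exact (G.adj_comm _ _).trans (hcross j i)
  · refine ⟨fun h e => hne (.inr i) (.inr j) h (congrArg _ e),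
      fun h => hfull _ _ (fun e => h ?_) ?_⟩
    · exact Sum.inr_injective (hψ.1 e)
    · exact iff_of_false (hRS i) (hRS j)

theorem exists_crossMatching_of_iso {a b r : ℕ} (hra : r ≤ a) (hrb : r ≤ b)
    (φ : G ≃g joinedCliques a b r) :
    ∃ S : Finset V, (∀ u w, u ≠ w → (u ∈ S ↔ w ∈ S) → G.Adj u w) ∧ #S = a ∧ #Sᶜ = b ∧
      #(crossEdges G S) = r ∧ CrossMatching G S := by
  let S : Finset V := {v | (φ v).isLeft}
  have hmem : ∀ v, v ∈ S ↔ ∃ i, φ v = Sum.inl i := fun v => by simp [S, Sum.isLeft_iff]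
  have hnmem : ∀ v, v ∉ S ↔ ∃ i, φ v = Sum.inr i := fun v => by
    simp [S, ← Sum.isRight_iff]
  have hSa : #S = a := by
    have : S = univ.image fun i : Fin a => φ.symm (Sum.inl i) := by
      ext v
      rw [hmem, mem_image]
      refine ⟨fun ⟨i, hi⟩ => ⟨i, mem_univ _, by rw [← hi]; simp⟩, fun ⟨i, _, hi⟩ => ⟨i, by simp [← hi]⟩⟩
    rw [this, card_image_of_injective _ fun i j h => Sum.inl_injective (φ.symm.injective h)]
    simp
  have hSb : #Sᶜ = b := by
    have : Sᶜ = univ.image fun i : Fin b => φ.symm (Sum.inr i) := by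
      ext v
      rw [mem_compl, hnmem, mem_image]
      refine ⟨fun ⟨i, hi⟩ => ⟨i, mem_univ _, by rw [← hi]; simp⟩, fun ⟨i, _, hi⟩ => ⟨i, by simp [← hi]⟩⟩
    rw [this, card_image_of_injective _ fun i j h => Sum.inr_injective (φ.symm.injective h)]
    simp
  have hcross : ∀ e, e ∈ crossEdges G S ↔ ∃ (i : Fin a) (j : Fin b),
      φ e.1 = Sum.inl i ∧ φ e.2 = Sum.inr j ∧ (i : ℕ) = j ∧ (i : ℕ) < r := by
    intro e
    rw [mem_crossEdges, hmem, hnmem, ← φ.map_adj_iff]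
    constructor
    · rintro ⟨⟨i, hi⟩, ⟨j, hj⟩, h⟩
      rw [hi, hj] at h
      exact ⟨i, j, hi, hj, h⟩
    · rintro ⟨i, j, hi, hj, h⟩
      refine ⟨⟨i, hi⟩, ⟨j, hj⟩, ?_⟩
      rw [hi, hj]
      exact h
  refine ⟨S, fun u w huw h => ?_, hSa, hSb, ?_, ?_⟩
  · rw [← φ.map_adj_iff]
    by_cases hu : u ∈ S
    · obtain ⟨i, hi⟩ := (hmem u).1 hu
      obtain ⟨j, hj⟩ := (hmem w).1 (h.1 hu)
      rw [hi, hj]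
      exact fun e => huw (φ.injective (by rw [hi, hj, show i = j from e]))
    · obtain ⟨i, hi⟩ := (hnmem u).1 hu
      obtain ⟨j, hj⟩ := (hnmem w).1 fun hw => hu (h.2 hw)
      rw [hi, hj]
      exact fun e => huw (φ.injective (by rw [hi, hj, show i = j from e]))
  · have : crossEdges G S = univ.image fun i : Fin r =>
        (φ.symm (Sum.inl (i.castLE hra)), φ.symm (Sum.inr (i.castLE hrb))) := by
      ext e
      rw [hcross, mem_image]
      constructor
      · rintro ⟨i, j, hi, hj, hij, hir⟩
        refine ⟨⟨i, hir⟩, mem_univ _, Prod.ext ?_ ?_⟩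
        · exact φ.symm_apply_eq.2 hi.symm
        · refine φ.symm_apply_eq.2 (Eq.trans ?_ hj.symm)
          exact congrArg _ (Fin.ext hij)
      · rintro ⟨i, -, rfl⟩
        exact ⟨i.castLE hra, i.castLE hrb, by simp, by simp, rfl, i.2⟩
    rw [this, card_image_of_injective, card_univ, Fintype.card_fin]
    intro i j h
    exact Fin.castLE_injective hra (Sum.inl_injective (φ.symm.injective (Prod.ext_iff.1 h).1))
  · intro e he f hf hef
    obtain ⟨i, j, hi, hj, hij, -⟩ := (hcross e).1 he
    obtain ⟨k, l, hk, hl, hkl, -⟩ := (hcross f).1 hf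
    have key : ¬ ((i : ℕ) = k) := by
      intro h
      refine hef (Prod.ext (φ.injective ?_) (φ.injective ?_))
      · rw [hi, hk, Fin.ext h]
      · rw [hj, hl, show j = l from Fin.ext (by omega)]
    constructor
    · intro h
      rw [h, hk] at hi
      exact key (by rw [Sum.inl_injective hi])
    · intro h
      rw [h, hl] at hj
      have := Sum.inr_injective hj
      subst this
      omega

end Isomorphism

/-! ### The main theorem. -/

/-- Among graphs with given order, minimum degree and smaller edge connectivity `r`, two cliques
joined by `r` disjoint edges uniquely maximize the number of spanning trees. -/
theorem numSpanningTrees_le_and_eq_iff_joinedCliques {V : Type*} [Fintype V] (G : SimpleGraph V) [DecidableRel G.Adj]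
    (n δ r : ℕ) (hr : 0 < r)
    (hn : Fintype.card V = n)
    (hconn : edgeConnectivity G = r)
    (hdeg : G.minDegree = δ)
    (hrδ : r < δ) (hnδ : 2 * δ + 2 ≤ n) :
    numSpanningTrees G ≤
        r * (δ + 1) ^ (δ - r) * (n - δ - 1) ^ (n - δ - r - 2) *
          ((δ + 1) * (n - δ - 1) + n) ^ (r - 1) ∧
      (numSpanningTrees G =
          r * (δ + 1) ^ (δ - r) * (n - δ - 1) ^ (n - δ - r - 2) *
            ((δ + 1) * (n - δ - 1) + n) ^ (r - 1) ↔
        Nonempty (G ≃g joinedCliques (n - δ - 1) (δ + 1) r)) := by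
  classical
  have hbound : ((r * (δ + 1) ^ (δ - r) * (n - δ - 1) ^ (n - δ - r - 2) *
      ((δ + 1) * (n - δ - 1) + n) ^ (r - 1) : ℕ) : ℝ) =
        joinedCliquesCount (n - δ - 1) (δ + 1) r := by
    rw [joinedCliquesCount_eq_cast hr (by omega) (by omega)]
    have e1 : δ + 1 - 1 - r = δ - r := by omega
    have e2 : n - δ - 1 - 1 - r = n - δ - r - 2 := by omega
    have e3 : n - δ - 1 + (δ + 1) = n := by omega
    rw [e1, e2, e3]
  set B := r * (δ + 1) ^ (δ - r) * (n - δ - 1) ^ (n - δ - r - 2) *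
      ((δ + 1) * (n - δ - 1) + n) ^ (r - 1) with hB
  have hV : Nonempty V := Fintype.card_pos_iff.1 (by omega)
  have hGconn : G.Connected := connected_of_edgeConnectivity_pos G (by omega)
  -- Exchanging sides if necessary makes `Sᶜ` the smaller one, to be compared with a clique of order
  -- `δ + 1`.
  obtain ⟨S, hSr, hSδ, hScδ, hle⟩ : ∃ S : Finset V, #(crossEdges G S) = r ∧ δ + 1 ≤ #S ∧
      δ + 1 ≤ #Sᶜ ∧ #Sᶜ ≤ #S := by
    obtain ⟨S, hS, hSc, hSr⟩ := exists_card_crossEdges_eq_edgeConnectivity G (by omega)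
    have h1 := minDegree_lt_card G S hS (by omega)
    have h2 := minDegree_lt_card G Sᶜ hSc (by rw [card_crossEdges_compl]; omega)
    rcases le_total #Sᶜ #S with h | h
    · exact ⟨S, by omega, by omega, by omega, h⟩
    · exact ⟨Sᶜ, by rw [card_crossEdges_compl]; omega, by omega,
        by rw [compl_compl]; omega, by rwa [compl_compl]⟩
  have hcard : #S + #Sᶜ = n := by rw [card_add_card_compl, hn]
  have hcrossH : #(crossEdges (fillSides G S) S) = r := by rw [crossEdges_fillSides, hSr]
  have hH := numSpanningTrees_le_of_full (fillSides G S) S (fun u w huw h => ⟨huw, Or.inl h⟩)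
    (by omega) (by omega) (card_pos.1 (by omega))
  rw [hcrossH] at hH
  have hGH : (numSpanningTrees G : ℝ) ≤ numSpanningTrees (fillSides G S) := by
    exact_mod_cast numSpanningTrees_mono (le_fillSides G S)
  have hcount : joinedCliquesCount #S #Sᶜ r ≤ joinedCliquesCount (n - δ - 1) (δ + 1) r ∧
      (joinedCliquesCount #S #Sᶜ r = joinedCliquesCount (n - δ - 1) (δ + 1) r → #Sᶜ = δ + 1) := by
    rcases hScδ.eq_or_lt with h | h
    · have : #S = n - δ - 1 := by omega
      rw [this, ← h]
      exact ⟨le_rfl, fun _ => rfl⟩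
    · have := joinedCliquesCount_lt (a := n - δ - 1) hr (by omega) h hle (by omega)
      exact ⟨this.le, fun e => absurd e this.ne⟩
  refine ⟨?_, fun heq => ?_, fun ⟨φ⟩ => ?_⟩
  · have : (numSpanningTrees G : ℝ) ≤ B := by
      rw [hbound]
      exact hGH.trans (hH.1.trans hcount.1)
    exact_mod_cast this
  -- Equality collapses the whole chain: the smaller side has order `δ + 1`, the cut is a matching,
  -- and filling the sides added no edge.
  · have heqR : (numSpanningTrees G : ℝ) = joinedCliquesCount (n - δ - 1) (δ + 1) r := by
      rw [← hbound, heq]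
    have h1 := hH.1
    have h2 := hcount.1
    have hb := hcount.2 (by linarith)
    have hM := hH.2.1 (by linarith)
    have hG : G = fillSides G S := by
      refine eq_of_numSpanningTrees_eq hGconn (le_fillSides G S) ?_
      exact_mod_cast (by linarith : (numSpanningTrees G : ℝ) = numSpanningTrees (fillSides G S))
    obtain ⟨φ⟩ := nonempty_iso_joinedCliques (fillSides G S) (a := n - δ - 1) (b := δ + 1)
      (fun u w huw h => ⟨huw, Or.inl h⟩) (by omega) hb hcrossH (by omega) (by omega) hM
    rw [← hG] at φ
    exact ⟨φ⟩
  · obtain ⟨T, hfull, hTa, hTb, hTr, hM⟩ := exists_crossMatching_of_iso G (by omega) (by omega) φ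
    have h := (numSpanningTrees_le_of_full G T hfull (by omega) (by omega)
      (card_pos.1 (by omega))).2.2 hM
    rw [hTa, hTb, hTr, ← hbound] at h
    exact_mod_cast h

end SpanningTreeMax

theorem theorem3p3 {V : Type*} [Fintype V] (G : SimpleGraph V) [DecidableRel G.Adj]
    (n δ r : ℕ) (hr : 0 < r)
    (hn : Fintype.card V = n)
    (hconn : SpanningTreeMax.edgeConnectivity G = r)
    (hdeg : G.minDegree = δ)
    (hrδ : r < δ) (hnδ : 2 * δ + 2 ≤ n) :
    SpanningTreeMax.numSpanningTrees G ≤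
        r * (δ + 1) ^ (δ - r) * (n - δ - 1) ^ (n - δ - r - 2) *
          ((δ + 1) * (n - δ - 1) + n) ^ (r - 1) ∧
      (SpanningTreeMax.numSpanningTrees G =
          r * (δ + 1) ^ (δ - r) * (n - δ - 1) ^ (n - δ - r - 2) *
            ((δ + 1) * (n - δ - 1) + n) ^ (r - 1) ↔
        Nonempty (G ≃g SpanningTreeMax.joinedCliques (n - δ - 1) (δ + 1) r)) :=
  SpanningTreeMax.numSpanningTrees_le_and_eq_iff_joinedCliques G n δ r hr hn hconn hdeg hrδ hnδ
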